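/- **Setting.** Let $(K,d)$ be a complete metric space. Let $N\subset\mathbb N$ with $1\in N$, let $(K_j)_{j\in N}$ be a partition of $K$ into non-empty Borel sets, let $E$ be an at most countable set, $i:E\to N$ surjective and $t:E\to N$. For every $e\in E$ let $w_e:K_{i(e)}\to K_{t(e)}$ and $p_e:K_{i(e)}\to[0,1]$ be Borel measurable, with $p_e$ not identically $0$ and $\sum_{e\in E,\,i(e)=j}p_e(y)=1$ for all $j\in N$, $y\in K_j$. Extend $p_e$ to $K$ by $0$ and $w_e$ to $K$ arbitrarily. $\mathcal M=(K_{i(e)},w_e,p_e)_{e\in E}$ is called a (countable) Markov system; it is *uniformly continuous* if $w_e|_{K_{i(e)}}$ and $p_e|_{K_{i(e)}}$ are uniformly continuous for every $e\in E$. Put $Uf:=\sum_{e\in E}p_e\cdot f\circ w_e$ for Borel $f\ge 0$, and let $P(\mathcal M)$ be the set of invariant measures, i.e. of Borel probability measures $\mu$ on $K$ with $\int Uf\,d\mu=\int f\,d\mu$ for all bounded Borel $f:K\to[0,\infty)$. *Code space.* Let $\bar E:=E\cup\{\infty\}$ be the one-point compactification of the discrete space $E$, with $i(\infty)=t(\infty)=1$,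 and $\bar\Sigma:=\bar E^{\mathbb Z}$ with the product topology and its Borel $\sigma$-algebra. Let $S$ be the left shift, $(S\sigma)_{n}=\sigma_{n+1}$, let $P_S(\bar\Sigma)$ be the set of $S$-invariant Borel probability measures on $\bar\Sigma$, let $\mathcal F$ be the $\sigma$-algebra generated by the coordinates $\sigma_n$, $n\le 0$, and ${}_1[e]:=\{\sigma:\sigma_1=e\}$. Let $\Sigma_G$ be the set of $\sigma\in\bar\Sigma$ with $\sigma_n\in E$ and $i(\sigma_{n+1})=t(\sigma_n)$ for all $n\in\mathbb Z$, and $T_j:=\{\sigma\in\Sigma_G: t(\sigma_0)=j\}$. *Coding map.* Fix $x_j\in K_j$ for every $j\in N$. Let $D$ be the set of $\sigma\in\Sigma_G$ for which $\lim_{m\to-\infty}w_{\sigma_0}\circ\dots\circ w_{\sigma_m}(x_{i(\sigma_m)})$ exists; let $F(\sigma)$ be this limit for $\sigma\in D$, and $F(\sigma):=x_{t(\sigma_0)}$ for $\sigma\in\bar\Sigma\setminus D$. For $\Lambda\in P_S(\bar\Sigma)$ let $F(\Lambda):=\Lambda\circ F^{-1}$ be the image measure on $K$. *Boundary objects.*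 Let $\mathcal M$ be uniformly continuous. Let $\bar w_e$ be the continuous extension of $w_e|_{K_{i(e)}}$ to $\overline{K_{i(e)}}$ (extended arbitrarily to $K$), let $\bar p_e$ be the continuous extension of $p_e|_{K_{i(e)}}$ to $\overline{K_{i(e)}}$, extended by $0$ to $K$, and $\partial p_e:=\bar p_e\,1_{\overline{K_{i(e)}}\setminus K_{i(e)}}$. Let $$\tilde E(\mathcal M):=\{\Lambda\in P_S(\bar\Sigma):\Lambda(D)=1,\ E_\Lambda(1_{{}_1[e]}|\mathcal F)=\bar p_e\circ F\;1_{T_{i(e)}}\ \Lambda\text{-a.e. for all }e\in E\},$$ $$E_\perp(\mathcal M):=\{\Lambda\in P_S(\bar\Sigma):\Lambda(D)=1,\ E_\Lambda(1_{{}_1[e]}|\mathcal F)=\partial p_e\circ F\;1_{T_{i(e)}}\ \Lambda\text{-a.e. for all }e\in E\}.$$ $\mathcal M$ is called *consistent* if $F(\Lambda)\in P(\mathcal M)$ for all $\Lambda\in\tilde E(\mathcal M)$. For Borel $f:K\to[0,\infty]$ put $Rf:=\sum_{e\in E}\partial p_e\cdot f\circ\bar w_e$, and let $\Omega:=\bigcap_{n\in\mathbb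 N}\{R^n1\ge 1\}$. **Theorem.** Let $\mathcal M$ be uniformly continuous. (i) $\mathcal M$ is consistent if and only if $F(\Lambda)\in P(\mathcal M)$ for all $\Lambda\in E_\perp(\mathcal M)$. (ii) If $(Rf)(F(\sigma))\le(Uf)(F(\sigma))$ for all $\sigma\in F^{-1}(\Omega)$ and all bounded Borel $f:K\to[0,\infty)$, then $\mathcal M$ is consistent. -/

import Mathlib

open Set Filter Topology MeasureTheory
open scoped ENNReal NNReal

/-! ### Code space -/

/-- The alphabet `Ē = E ∪ {∞}` carries the σ-algebra of all its subsets. -/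
instance OnePoint.instMeasurableSpaceTop (E : Type*) : MeasurableSpace (OnePoint E) := ⊤

/-- The code space: bi-infinite sequences over `Ē = E ∪ {∞}`, with the product σ-algebra
(for countable discrete `E` it is the Borel σ-algebra of the product topology, see
`CodeSpace.borel_eq` below). -/
abbrev CodeSpace (E : Type*) : Type _ := ℤ → OnePoint E

namespace CodeSpace

/-- The one-point compactification of a countable discrete space has a countable base. -/
theorem secondCountable_onePoint (E : Type*) [Countable E] [TopologicalSpace E]
    [DiscreteTopology E] : SecondCountableTopology (OnePoint E) := by
  have hb : TopologicalSpace.IsTopologicalBasis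
      ((range fun e : E => ({(e : OnePoint E)} : Set (OnePoint E))) ∪
        range fun s : Finset E => (((↑) : E → OnePoint E) '' (s : Set E))ᶜ) := by
    refine TopologicalSpace.isTopologicalBasis_of_isOpen_of_nhds ?_ ?_
    · rintro u (⟨e, rfl⟩ | ⟨s, rfl⟩)
      · have := OnePoint.isOpen_image_coe.2 (isOpen_discrete ({e} : Set E))
        simpa using this
      · exact OnePoint.isOpen_compl_image_coe.2
          ⟨isClosed_discrete _, s.finite_toSet.isCompact⟩
    · intro a u ha hu
      induction a using OnePoint.rec with
      | infty =>
        have h := (OnePoint.isOpen_iff_of_mem ha).1 hu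
        have hf : (((↑) : E → OnePoint E) ⁻¹' u)ᶜ.Finite := h.2.finite_of_discrete
        refine ⟨_, Or.inr ⟨hf.toFinset, rfl⟩, by simp, ?_⟩
        intro y hy
        induction y using OnePoint.rec with
        | infty => exact ha
        | coe y => by_contra hyu; exact hy ⟨y, by simpa using hyu, rfl⟩
      | coe e => exact ⟨_, Or.inl ⟨e, rfl⟩, rfl, by simpa using ha⟩
  exact hb.secondCountableTopology ((countable_range _).union (countable_range _))

/-- For countable discrete `E`, the σ-algebra used on the code space is the Borel σ-algebra of
the product of the one-point compactification topologies. -/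
theorem borel_eq (E : Type*) [Countable E] [TopologicalSpace E] [DiscreteTopology E] :
    borel (CodeSpace E) = (inferInstance : MeasurableSpace (CodeSpace E)) := by
  have := secondCountable_onePoint E
  have : Countable (OnePoint E) := inferInstanceAs (Countable (Option E))
  have : BorelSpace (OnePoint E) := ⟨by
    refine le_antisymm (fun s _ => ?_) le_top
    let _ : MeasurableSpace (OnePoint E) := borel (OnePoint E)
    have : BorelSpace (OnePoint E) := ⟨rfl⟩
    exact s.to_countable.measurableSet⟩
  exact (Pi.borelSpace (X := fun _ : ℤ => OnePoint E)).measurable_eq.symm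

variable {E : Type*}

/-- The left shift, `(S σ)_{n-1} = σ_n`. -/
def shift (σ : CodeSpace E) : CodeSpace E := fun n => σ (n + 1)

/-- The σ-algebra `𝓕` generated by the coordinates `σ_n`, `n ≤ 0`, i.e. by the cylinder sets
`{σ | σ_m = e_m, …, σ_0 = e_0}`, `m ≤ 0`. -/
abbrev past (E : Type*) : MeasurableSpace (CodeSpace E) :=
  ⨆ n : {n : ℤ // n ≤ 0}, MeasurableSpace.comap (fun σ : CodeSpace E => σ n) ⊤

/-- The indicator function of the cylinder set `{σ | σ_1 = e}`. -/
noncomputable def indOne (e : E) : CodeSpace E → ℝ :=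
  {σ : CodeSpace E | σ 1 = (e : OnePoint E)}.indicator fun _ => 1

/-- Shift-invariant probability measures on the code space. -/
def invariantProb (E : Type*) : Set (Measure (CodeSpace E)) :=
  {Λ | IsProbabilityMeasure Λ ∧ MeasurePreserving shift Λ Λ}

end CodeSpace

/-! ### Markov systems -/

/-- A Markov system on `K` with index set `E`. The maps `w e` are of interest on `cell (i e)` only
(their values elsewhere are arbitrary); the probability functions `p e` are extended by zero. -/
structure MarkovSystem (K E : Type*) [MeasurableSpace K] where
  /-- index set of the partition -/
  N : Set ℕ
  one_mem : 1 ∈ N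
  /-- vertex sets -/
  cell : N → Set K
  cell_measurable : ∀ j, MeasurableSet (cell j)
  cell_nonempty : ∀ j, (cell j).Nonempty
  cell_disjoint : Pairwise fun j k => Disjoint (cell j) (cell k)
  cell_cover : ⋃ j, cell j = univ
  /-- initial vertex -/
  i : E → N
  i_surjective : Function.Surjective i
  /-- terminal vertex -/
  t : E → N
  /-- maps -/
  w : E → K → K
  w_measurable : ∀ e, Measurable fun y : cell (i e) => w e y
  w_mapsTo : ∀ e, MapsTo (w e) (cell (i e)) (cell (t e))
  /-- probability functions -/
  p : E → K → ℝ
  p_measurable : ∀ e, Measurable (p e)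
  p_nonneg : ∀ e y, 0 ≤ p e y
  p_le_one : ∀ e y, p e y ≤ 1
  p_eq_zero : ∀ e y, y ∉ cell (i e) → p e y = 0
  p_pos : ∀ e, ∃ y ∈ cell (i e), 0 < p e y
  p_sum : ∀ j, ∀ y ∈ cell j, HasSum (fun e : {e : E // i e = j} => p e y) 1

namespace MarkovSystem

variable {K E : Type*} [MeasurableSpace K] (M : MarkovSystem K E)

/-- The Markov operator `U f = ∑ₑ pₑ · f ∘ wₑ`. -/
noncomputable def U (f : K → ℝ≥0∞) (y : K) : ℝ≥0∞ :=
  ∑' e, ENNReal.ofReal (M.p e y) * f (M.w e y)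

/-- `P(M)`: the Borel probability measures `μ` with `U* μ = μ`, i.e. `∫ U f dμ = ∫ f dμ` for all
bounded nonnegative Borel functions `f`. -/
def invariantMeasures : Set (Measure K) :=
  {μ | IsProbabilityMeasure μ ∧ ∀ f : K → ℝ≥0, Measurable f → (∃ C, ∀ y, f y ≤ C) →
    ∫⁻ y, M.U (fun z => (f z : ℝ≥0∞)) y ∂μ = ∫⁻ y, (f y : ℝ≥0∞) ∂μ}

/-- `i` extended by `i(∞) = 1`. -/
def iExt (a : OnePoint E) : M.N := a.elim ⟨1, M.one_mem⟩ M.i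

/-- `t` extended by `t(∞) = 1`. -/
def tExt (a : OnePoint E) : M.N := a.elim ⟨1, M.one_mem⟩ M.t

/-- `w` extended by `w_∞ = id`. -/
def wExt (a : OnePoint E) : K → K := a.elim id M.w

/-- The path space `Σ_G`. -/
def pathSpace : Set (CodeSpace E) :=
  {σ | ∀ n : ℤ, M.iExt (σ (n + 1)) = M.tExt (σ n) ∧ σ n ≠ OnePoint.infty}

/-- `T_j`, the set of paths `σ` with `t(σ_0) = j`. -/
def T (j : M.N) : Set (CodeSpace E) := {σ ∈ M.pathSpace | M.tExt (σ 0) = j}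

/-- `w_{σ_0} ∘ w_{σ_{-1}} ∘ … ∘ w_{σ_{-n}}`. -/
def backComp (σ : CodeSpace E) : ℕ → K → K
  | 0 => M.wExt (σ 0)
  | n + 1 => backComp σ n ∘ M.wExt (σ (-((n : ℤ) + 1)))

section Topological

variable [TopologicalSpace K] (x : M.N → K)

/-- The set `D` of paths along which `w_{σ_0} ∘ … ∘ w_{σ_m} (x_{i(σ_m)})` converges
as `m → -∞`. -/
def D : Set (CodeSpace E) :=
  {σ | σ ∈ M.pathSpace ∧
    ∃ y, Tendsto (fun n : ℕ => M.backComp σ n (x (M.iExt (σ (-(n : ℤ)))))) atTop (𝓝 y)}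

open Classical in
/-- The coding map `F`. -/
noncomputable def coding (σ : CodeSpace E) : K :=
  if h : σ ∈ M.D x then h.2.choose else x (M.tExt (σ 0))

/-- The continuous extension of `w_e` from `K_{i(e)}` to its closure
(off the closure the values are irrelevant). -/
noncomputable def wBar (e : E) : K → K := extendFrom (M.cell (M.i e)) (M.w e)

/-- The continuous extension of `p_e` from `K_{i(e)}` to its closure, extended by zero. -/
noncomputable def pBar (e : E) : K → ℝ :=
  (closure (M.cell (M.i e))).indicator (extendFrom (M.cell (M.i e)) (M.p e))

/-- `∂p_e`: the restriction of the extension of `p_e` to `closure K_{i(e)} \ K_{i(e)}`, extended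
by zero. -/
noncomputable def pBdry (e : E) : K → ℝ :=
  (closure (M.cell (M.i e)) \ M.cell (M.i e)).indicator (M.pBar e)

/-- `Ẽ(M)`: the asymptotic states. -/
def asymptoticStates : Set (Measure (CodeSpace E)) :=
  {Λ | Λ ∈ CodeSpace.invariantProb E ∧ Λ (M.D x) = 1 ∧
    ∀ e, condExp (CodeSpace.past E) Λ (CodeSpace.indOne e) =ᵐ[Λ]
      (M.T (M.i e)).indicator fun σ => M.pBar e (M.coding x σ)}

/-- `E_⊥(M)`. -/
def Eperp : Set (Measure (CodeSpace E)) :=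
  {Λ | Λ ∈ CodeSpace.invariantProb E ∧ Λ (M.D x) = 1 ∧
    ∀ e, condExp (CodeSpace.past E) Λ (CodeSpace.indOne e) =ᵐ[Λ]
      (M.T (M.i e)).indicator fun σ => M.pBdry e (M.coding x σ)}

/-- The operator `R f = ∑ₑ ∂pₑ · f ∘ w̄ₑ`. -/
noncomputable def R (f : K → ℝ≥0∞) (y : K) : ℝ≥0∞ :=
  ∑' e, ENNReal.ofReal (M.pBdry e y) * f (M.wBar e y)

/-- `Ω = ⋂ₙ {Rⁿ 1 ≥ 1}`. -/
def Omega : Set K := ⋂ n : ℕ, {y | 1 ≤ (M.R^[n]) (fun _ => 1) y}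

/-- Consistency (meant for uniformly continuous systems): `F(Λ) ∈ P(M)` for every asymptotic
state `Λ`. -/
def IsConsistent : Prop :=
  ∀ Λ ∈ M.asymptoticStates x, Measure.map (M.coding x) Λ ∈ M.invariantMeasures

end Topological

/-- Uniform continuity of a Markov system. -/
def IsUniformlyContinuous [UniformSpace K] : Prop :=
  ∀ e, UniformContinuousOn (M.w e) (M.cell (M.i e)) ∧
    UniformContinuousOn (M.p e) (M.cell (M.i e))

/-- The system is uniformly continuous, and `(R f) ∘ F ≤ (U f) ∘ F` on `F⁻¹(Ω)` for all bounded
nonnegative Borel functions `f`. -/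
def BoundaryDomination [UniformSpace K] (x : M.N → K) : Prop :=
  M.IsUniformlyContinuous ∧
    ∀ f : K → ℝ≥0, Measurable f → (∃ C, ∀ y, f y ≤ C) →
      ∀ σ ∈ M.coding x ⁻¹' M.Omega,
        M.R (fun z => (f z : ℝ≥0∞)) (M.coding x σ) ≤ M.U (fun z => (f z : ℝ≥0∞)) (M.coding x σ)

end MarkovSystem

/-!
Under a measure in `Ẽ(M)`, the coded point `F σ` moves, conditionally on the past, along `w̄_e`
with probability `p̄_e (F σ)`, where `e` leaves the vertex reached by `σ`. Let `A` be the event that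
`F σ` lies in the cell of that vertex. It depends on the past only (after `F` is changed on a null
set), and the shift maps `A` into itself, so by stationarity `A` is invariant up to a null set. On
`A` the motion is the one described by `U`. Off `A` one has `p̄_e = ∂p_e`, so conditioning on the
complement of `A` gives a member of `E_⊥(M)`. Conversely `A` is null under a member of `E_⊥(M)`,
because `∂p_e` vanishes on the cell, so such a member belongs to `Ẽ(M)`. This is (i).

For (ii), let `Λ ∈ E_⊥(M)`. Then the conditional expectation of `f ∘ F ∘ S` is at most `(R f) ∘ F`.
Iterating this with `f = 1` shows that `F σ ∈ Ω` almost surely, whence `∫ f dF(Λ) ≤ ∫ U f dF(Λ)` for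
every bounded `f ≥ 0`. The same inequality for `C - f`, together with `U C = C`, gives equality.
-/

section Conditioning

variable {Ω : Type*} {m m0 : MeasurableSpace Ω} {μ : Measure Ω}

theorem condLExp_mul_of_measurable_left (hm : m ≤ m0) [SigmaFinite (μ.trim hm)]
    {f g : Ω → ℝ≥0∞} (hf : Measurable[m] f) (hg : Measurable g) :
    μ⁻[f * g|m] =ᵐ[μ] f * μ⁻[g|m] := by
  have hgm := measurable_condLExp m μ g
  have hmeas : (μ.withDensity μ⁻[g|m]).trim hm = (μ.withDensity g).trim hm := by
    refine @Measure.ext _ m _ _ fun s hs => ?_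
    rw [trim_measurableSet_eq hm hs, trim_measurableSet_eq hm hs, withDensity_apply _ (hm s hs),
      withDensity_apply _ (hm s hs), setLIntegral_condLExp hm μ g hs]
  have hlintegral {h : Ω → ℝ≥0∞} (hh : Measurable[m] h) :
      ∫⁻ ω, (h * μ⁻[g|m]) ω ∂μ = ∫⁻ ω, (h * g) ω ∂μ := by
    rw [mul_comm h, mul_comm h,
      ← lintegral_withDensity_eq_lintegral_mul _ (hgm.mono hm le_rfl) (hh.mono hm le_rfl),
      ← lintegral_withDensity_eq_lintegral_mul _ hg (hh.mono hm le_rfl),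
      ← lintegral_trim hm hh, ← lintegral_trim hm hh, hmeas]
  refine (ae_eq_condLExp hm μ (f * g) (hf.mul hgm) fun s hs => ?_).symm
  rw [← lintegral_indicator (hm s hs), ← lintegral_indicator (hm s hs)]
  simpa only [Pi.mul_apply, ← indicator_mul_left] using! hlintegral (hf.indicator hs)

theorem condExp_cond_ae_eq (hm : m ≤ m0) [IsFiniteMeasure μ] {B : Set Ω}
    (hB : MeasurableSet[m] B) {f : Ω → ℝ} (hf : Integrable f μ) :
    condExp m (ProbabilityTheory.cond μ B) f =ᵐ[ProbabilityTheory.cond μ B] condExp m μ f := by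
  by_cases h0 : μ B = 0
  · rw [ProbabilityTheory.cond_eq_zero_of_meas_eq_zero h0]
    exact ae_zero.le Filter.mem_bot
  have hc : (μ B)⁻¹ ≠ ∞ := ENNReal.inv_ne_top.2 h0
  symm
  refine ae_eq_condExp_of_forall_setIntegral_eq hm (hf.restrict.smul_measure hc)
    (fun s _ _ => (integrable_condExp.restrict.smul_measure hc).integrableOn)
    (fun s hs _ => ?_) stronglyMeasurable_condExp.aestronglyMeasurable
  rw [ProbabilityTheory.cond, Measure.restrict_smul, integral_smul_measure, integral_smul_measure,
    Measure.restrict_restrict (hm s hs), setIntegral_condExp hm hf (hs.inter hB)]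

end Conditioning

section Extension

theorem exists_tendsto_nhdsWithin_of_uniformContinuousOn {α β : Type*} [UniformSpace α]
    [UniformSpace β] [CompleteSpace β] {f : α → β} {s : Set α} (hf : UniformContinuousOn f s)
    {y : α} (hy : y ∈ closure s) : ∃ z, Tendsto f (𝓝[s] y) (𝓝 z) := by
  have : (𝓝[s] y).NeBot := mem_closure_iff_nhdsWithin_neBot.1 hy
  have hle : 𝓝[s] y ×ˢ 𝓝[s] y ≤ uniformity α ⊓ 𝓟 (s ×ˢ s) :=
    le_inf ((cauchy_nhds (a := y)).mono nhdsWithin_le_nhds).2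
      (le_principal_iff.2 (prod_mem_prod self_mem_nhdsWithin self_mem_nhdsWithin))
  exact cauchy_map_iff_exists_tendsto.1 (cauchy_map_iff.2 ⟨this, hf.mono_left hle⟩)

theorem measurable_indicator_comp {α β γ : Type*} [MeasurableSpace α] [MeasurableSpace β]
    [MeasurableSpace γ] [Zero γ] {f : α → β} {s : Set α} (hs : MeasurableSet s)
    (hf : Measurable fun y : s => f y) {g : β → γ} (hg : Measurable g) :
    Measurable (s.indicator (g ∘ f)) := by
  refine measurable_of_restrict_of_restrict_compl hs ?_ ?_
  · rw [domRestrict_eq_domRestrict_iff.2 eqOn_indicator]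
    exact hg.comp hf
  · rw [domRestrict_eq_domRestrict_iff.2 eqOn_indicator']
    exact measurable_const

theorem measurable_indicator_closure_comp_extendFrom {α β γ : Type*} [UniformSpace α]
    [MeasurableSpace α] [OpensMeasurableSpace α] [UniformSpace β] [CompleteSpace β]
    [T3Space β] [MeasurableSpace β] [BorelSpace β] [MeasurableSpace γ] [Zero γ] {f : α → β}
    {s : Set α} (hf : UniformContinuousOn f s) {g : β → γ} (hg : Measurable g) :
    Measurable ((closure s).indicator (g ∘ extendFrom s f)) :=
  have hcont : ContinuousOn (extendFrom s f) (closure s) :=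
    continuousOn_extendFrom subset_rfl fun _ => exists_tendsto_nhdsWithin_of_uniformContinuousOn hf
  measurable_indicator_comp isClosed_closure.measurableSet hcont.domRestrict.measurable hg

theorem measurable_tsum_ofReal_mul_comp {ι α β : Type*} [Countable ι] [MeasurableSpace α]
    {s : ι → Set α} {q : ι → α → ℝ} {v : ι → α → β} {f : β → ℝ≥0∞}
    (hq : ∀ e, Measurable (q e)) (hq0 : ∀ e, ∀ y ∉ s e, q e y = 0)
    (hfv : ∀ e, Measurable ((s e).indicator (f ∘ v e))) :
    Measurable fun y => ∑' e, ENNReal.ofReal (q e y) * f (v e y) := by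
  have h (e : ι) (y : α) : ENNReal.ofReal (q e y) * f (v e y) =
      ENNReal.ofReal (q e y) * (s e).indicator (f ∘ v e) y := by
    by_cases hy : y ∈ s e
    · rw [indicator_of_mem hy, Function.comp_apply]
    · rw [hq0 e y hy, ENNReal.ofReal_zero, zero_mul, zero_mul]
  simp only [h]
  exact Measurable.tsum fun e => (hq e).ennreal_ofReal.mul (hfv e)

end Extension

namespace CodeSpace

variable {E : Type*}

theorem past_le : past E ≤ (inferInstance : MeasurableSpace (CodeSpace E)) :=
  iSup_le fun n => (measurable_pi_apply (n : ℤ)).comap_le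

theorem measurable_past_apply {n : ℤ} (hn : n ≤ 0) :
    Measurable[past E] fun σ : CodeSpace E => σ n :=
  measurable_iff_comap_le.2 <|
    le_iSup (fun n : {n : ℤ // n ≤ 0} =>
      MeasurableSpace.comap (fun σ : CodeSpace E => σ n) ⊤) ⟨n, hn⟩

theorem stronglyMeasurable_past_of_dependsOn [Countable E] {β : Type*} [TopologicalSpace β]
    {f : CodeSpace E → β} {s : Set ℤ} (hs : s.Finite) (hs0 : s ⊆ Iic 0) (hf : DependsOn f s) :
    StronglyMeasurable[past E] f := by
  have : Countable (OnePoint E) := inferInstanceAs (Countable (Option E))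
  have : Nonempty β := ⟨f fun _ => OnePoint.infty⟩
  have := hs.to_subtype
  obtain ⟨g, rfl⟩ := dependsOn_iff_exists_comp.1 hf
  have hr : Measurable[past E] (s.domRestrict : CodeSpace E → s → OnePoint E) :=
    @measurable_pi_lambda _ _ _ (past E) _ _ fun k => measurable_past_apply (hs0 k.2)
  exact (StronglyMeasurable.of_discrete (f := g)).comp_measurable hr

theorem measurableSet_apply_eq (n : ℤ) (a : OnePoint E) :
    MeasurableSet {σ : CodeSpace E | σ n = a} :=
  @measurable_pi_apply ℤ (fun _ => OnePoint E) _ n {a} .of_discrete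

theorem measurable_indOne (e : E) : Measurable (indOne e) :=
  measurable_const.indicator (measurableSet_apply_eq 1 _)

theorem indOne_nonneg (e : E) : 0 ≤ indOne e :=
  indicator_nonneg fun _ _ => zero_le_one

theorem integrable_indOne (Λ : Measure (CodeSpace E)) [IsFiniteMeasure Λ] (e : E) :
    Integrable (indOne e) Λ :=
  (integrable_const (1 : ℝ)).indicator (measurableSet_apply_eq 1 _)

theorem indOne_of_eq {e : E} {σ : CodeSpace E} (he : σ 1 = (e : OnePoint E)) : indOne e σ = 1 :=
  indicator_of_mem (s := {σ : CodeSpace E | σ 1 = e}) he _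

theorem indOne_of_ne {e : E} {σ : CodeSpace E} (he : σ 1 ≠ (e : OnePoint E)) : indOne e σ = 0 :=
  indicator_of_notMem (s := {σ : CodeSpace E | σ 1 = e}) he _

end CodeSpace

namespace MarkovSystem

section Operator

variable {K E : Type*} [MeasurableSpace K] {M : MarkovSystem K E}

protected theorem nonempty (M : MarkovSystem K E) : Nonempty K :=
  ⟨(M.cell_nonempty ⟨1, M.one_mem⟩).some⟩

theorem eq_of_mem_cell {j k : M.N} {y : K} (hj : y ∈ M.cell j) (hk : y ∈ M.cell k) : j = k := by
  by_contra h
  exact disjoint_left.1 (M.cell_disjoint h) hj hk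

theorem exists_mem_cell (M : MarkovSystem K E) (y : K) : ∃ j, y ∈ M.cell j :=
  mem_iUnion.1 (M.cell_cover.ge (mem_univ y))

theorem p_eq_zero_of_mem_cell {j : M.N} {y : K} (hy : y ∈ M.cell j) {e : E} (he : M.i e ≠ j) :
    M.p e y = 0 :=
  M.p_eq_zero e y fun h => he (eq_of_mem_cell h hy)

theorem tsum_ofReal_p (M : MarkovSystem K E) (y : K) :
    ∑' e, ENNReal.ofReal (M.p e y) = 1 := by
  obtain ⟨j, hj⟩ := M.exists_mem_cell y
  have hs := M.p_sum j y hj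
  have hsupp : (Function.support fun e => ENNReal.ofReal (M.p e y)) ⊆ {e | M.i e = j} := by
    intro e he
    by_contra h
    exact he (by simp only [p_eq_zero_of_mem_cell hj h, ENNReal.ofReal_zero])
  rw [← tsum_subtype_eq_of_support_subset hsupp, ← ENNReal.ofReal_one, ← hs.tsum_eq]
  exact (ENNReal.ofReal_tsum_of_nonneg (fun e => M.p_nonneg _ _) hs.summable).symm

theorem U_const (c : ℝ≥0∞) (y : K) : M.U (fun _ => c) y = c := by
  rw [U, ENNReal.tsum_mul_right, tsum_ofReal_p, one_mul]

theorem U_add (f g : K → ℝ≥0∞) (y : K) : M.U (f + g) y = M.U f y + M.U g y := by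
  simp only [U, Pi.add_apply, mul_add, ENNReal.tsum_add]

theorem measurable_U [Countable E] {f : K → ℝ≥0∞} (hf : Measurable f) : Measurable (M.U f) :=
  measurable_tsum_ofReal_mul_comp M.p_measurable M.p_eq_zero fun e =>
    measurable_indicator_comp (M.cell_measurable _) (M.w_measurable e) hf

-- The reverse inequality is the hypothesis for `C - f`, because `U C = C`.
theorem mem_invariantMeasures_of_lintegral_le_lintegral_U [Countable E] {μ : Measure K}
    [IsProbabilityMeasure μ]
    (hle : ∀ f : K → ℝ≥0, Measurable f → (∃ C, ∀ y, f y ≤ C) →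
      ∫⁻ y, (f y : ℝ≥0∞) ∂μ ≤ ∫⁻ y, M.U (fun z => (f z : ℝ≥0∞)) y ∂μ) :
    μ ∈ M.invariantMeasures := by
  refine ⟨inferInstance, fun f hf ⟨C, hC⟩ => le_antisymm ?_ (hle f hf ⟨C, hC⟩)⟩
  let F : K → ℝ≥0∞ := fun y => f y
  let G : K → ℝ≥0∞ := fun y => ((C - f y : ℝ≥0) : ℝ≥0∞)
  have hF : Measurable F := hf.coe_nnreal_ennreal
  have hFG : F + G = fun _ => (C : ℝ≥0∞) := funext fun y => by
    simp only [F, G, Pi.add_apply, ← ENNReal.coe_add, add_tsub_cancel_of_le (hC y)]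
  have hlintegral : ∫⁻ y, F y ∂μ + ∫⁻ y, G y ∂μ = C := by
    rw [← lintegral_add_left hF]
    simpa using congrArg (fun h => ∫⁻ y, h y ∂μ) hFG
  have hlintegralU : ∫⁻ y, M.U F y ∂μ + ∫⁻ y, M.U G y ∂μ = C := by
    rw [← lintegral_add_left (measurable_U hF)]
    simp only [← U_add, hFG, U_const, lintegral_const, measure_univ, mul_one]
  have hG : ∫⁻ y, G y ∂μ ≤ ∫⁻ y, M.U G y ∂μ :=
    hle (fun y => C - f y) (measurable_const.sub hf) ⟨C, fun _ => tsub_le_self⟩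
  have hGtop : ∫⁻ y, G y ∂μ ≠ ∞ :=
    ne_top_of_le_ne_top ENNReal.coe_ne_top (hlintegral ▸ le_add_self)
  refine (ENNReal.add_le_add_iff_right hGtop).1 ?_
  calc ∫⁻ y, M.U F y ∂μ + ∫⁻ y, G y ∂μ ≤ ∫⁻ y, M.U F y ∂μ + ∫⁻ y, M.U G y ∂μ := by gcongr
    _ = ∫⁻ y, F y ∂μ + ∫⁻ y, G y ∂μ := by rw [hlintegralU, hlintegral]

end Operator

section Paths

variable {K E : Type*} [MeasurableSpace K] {M : MarkovSystem K E} {x : M.N → K}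
  {σ : CodeSpace E}

theorem tExt_zero_eq_i (hσ : σ ∈ M.pathSpace) {e : E} (he : σ 1 = (e : OnePoint E)) :
    M.tExt (σ 0) = M.i e :=
  (hσ 0).1.symm.trans (congrArg M.iExt he)

theorem exists_apply_one_eq (hσ : σ ∈ M.pathSpace) : ∃ e : E, σ 1 = (e : OnePoint E) :=
  (OnePoint.ne_infty_iff_exists.1 (hσ 1).2).imp fun _ he => he.symm

theorem tExt_shift_zero {e : E} (he : σ 1 = (e : OnePoint E)) :
    M.tExt (CodeSpace.shift σ 0) = M.t e :=
  congrArg M.tExt he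

theorem wExt_mem_cell {a : OnePoint E} (ha : a ≠ OnePoint.infty) {y : K}
    (hy : y ∈ M.cell (M.iExt a)) : M.wExt a y ∈ M.cell (M.tExt a) := by
  obtain ⟨e, rfl⟩ := OnePoint.ne_infty_iff_exists.1 ha
  exact M.w_mapsTo e hy

theorem dependsOn_backComp (M : MarkovSystem K E) (n : ℕ) :
    DependsOn (fun σ => M.backComp σ n) (Icc (-(n : ℤ)) 0) := by
  intro σ τ h
  induction n with
  | zero => exact congrArg M.wExt (h 0 (by simp))
  | succ n ih =>
    have hlast : σ (-((n : ℤ) + 1)) = τ (-((n : ℤ) + 1)) := h _ (by simp)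
    have hinit : M.backComp σ n = M.backComp τ n :=
      ih fun k hk => h k ⟨by have := hk.1; push_cast; omega, hk.2⟩
    simp only [backComp, hlast, hinit]

theorem backComp_mem_cell (hσ : σ ∈ M.pathSpace) (n : ℕ) {y : K}
    (hy : y ∈ M.cell (M.iExt (σ (-(n : ℤ))))) : M.backComp σ n y ∈ M.cell (M.tExt (σ 0)) := by
  induction n generalizing y with
  | zero => exact wExt_mem_cell (hσ 0).2 (by simpa using hy)
  | succ n ih =>
    have hstep : M.iExt (σ (-(n : ℤ))) = M.tExt (σ (-((n : ℤ) + 1))) := by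
      simpa using (hσ (-((n : ℤ) + 1))).1
    have hw : M.wExt (σ (-((n : ℤ) + 1))) y ∈ M.cell (M.tExt (σ (-((n : ℤ) + 1)))) :=
      wExt_mem_cell (hσ _).2 (by exact_mod_cast hy)
    exact ih (hstep ▸ hw)

theorem backComp_shift (σ : CodeSpace E) (n : ℕ) :
    M.backComp (CodeSpace.shift σ) (n + 1) = M.wExt (σ 1) ∘ M.backComp σ n := by
  induction n with
  | zero => simp [backComp, CodeSpace.shift]
  | succ n ih =>
    rw [backComp, ih, backComp, Function.comp_assoc]
    congr 3

/-- The points `w_{σ_0} ∘ … ∘ w_{σ_{-n}} (x_{i(σ_{-n})})` whose limit is the coding map. -/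
def backPoint (M : MarkovSystem K E) (x : M.N → K) (n : ℕ) (σ : CodeSpace E) : K :=
  M.backComp σ n (x (M.iExt (σ (-(n : ℤ)))))

theorem dependsOn_backPoint (M : MarkovSystem K E) (x : M.N → K) (n : ℕ) :
    DependsOn (M.backPoint x n) (Icc (-(n : ℤ)) 0) := by
  intro σ τ h
  have hcomp : M.backComp σ n = M.backComp τ n := M.dependsOn_backComp n h
  have hlast : σ (-(n : ℤ)) = τ (-(n : ℤ)) := h _ (by simp)
  rw [backPoint, backPoint, hcomp, hlast]

theorem stronglyMeasurable_backPoint [Countable E] [TopologicalSpace K] (M : MarkovSystem K E)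
    (x : M.N → K) (n : ℕ) : StronglyMeasurable[CodeSpace.past E] (M.backPoint x n) :=
  CodeSpace.stronglyMeasurable_past_of_dependsOn (finite_Icc _ _) (fun _ hk => hk.2)
    (M.dependsOn_backPoint x n)

theorem backPoint_mem_cell (hx : ∀ j, x j ∈ M.cell j) (hσ : σ ∈ M.pathSpace) (n : ℕ) :
    M.backPoint x n σ ∈ M.cell (M.tExt (σ 0)) :=
  backComp_mem_cell hσ n (hx _)

theorem backPoint_shift (σ : CodeSpace E) (n : ℕ) :
    M.backPoint x (n + 1) (CodeSpace.shift σ) = M.wExt (σ 1) (M.backPoint x n σ) := by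
  have hlast : CodeSpace.shift σ (-((n + 1 : ℕ) : ℤ)) = σ (-(n : ℤ)) := by simp [CodeSpace.shift]
  rw [backPoint, backComp_shift, hlast, backPoint, Function.comp_apply]

theorem measurableSet_pathSpace (M : MarkovSystem K E) : MeasurableSet M.pathSpace := by
  have hExt {k : OnePoint E → M.N} (n : ℤ) : Measurable fun σ : CodeSpace E => k (σ n) :=
    (measurable_from_top (f := k)).comp (measurable_pi_apply n)
  have : M.pathSpace = ⋂ n : ℤ, ({σ | M.iExt (σ (n + 1)) = M.tExt (σ n)} ∩
      {σ : CodeSpace E | σ n = OnePoint.infty}ᶜ) := by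
    ext σ
    simp only [mem_iInter]
    rfl
  rw [this]
  exact .iInter fun n =>
    (measurableSet_eq_fun (hExt _) (hExt _)).inter (CodeSpace.measurableSet_apply_eq _ _).compl

end Paths

section BoundaryExtension

variable {K E : Type*} [MeasurableSpace K] {M : MarkovSystem K E} {e : E} {y : K}

section Topological

variable [TopologicalSpace K]

theorem pBdry_eq_zero_of_mem (hy : y ∈ M.cell (M.i e)) : M.pBdry e y = 0 :=
  indicator_of_notMem (fun h => h.2 hy) _

theorem pBdry_eq_zero_of_notMem_closure (hy : y ∉ closure (M.cell (M.i e))) : M.pBdry e y = 0 :=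
  indicator_of_notMem (fun h => hy h.1) _

theorem pBdry_eq_pBar (hy : y ∉ M.cell (M.i e)) : M.pBdry e y = M.pBar e y := by
  by_cases hc : y ∈ closure (M.cell (M.i e))
  · exact indicator_of_mem (s := _ \ _) ⟨hc, hy⟩ _
  · rw [pBdry_eq_zero_of_notMem_closure hc, pBar, indicator_of_notMem hc]

end Topological

variable [UniformSpace K]

theorem pBar_eq_p (hM : M.IsUniformlyContinuous) (hy : y ∈ M.cell (M.i e)) :
    M.pBar e y = M.p e y := by
  rw [pBar, indicator_of_mem (subset_closure hy)]
  exact extendFrom_eq (subset_closure hy) ((hM e).2.continuousOn y hy)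

theorem wBar_eq_w [T2Space K] (hM : M.IsUniformlyContinuous) (hy : y ∈ M.cell (M.i e)) :
    M.wBar e y = M.w e y :=
  extendFrom_eq (subset_closure hy) ((hM e).1.continuousOn y hy)

variable [BorelSpace K]

theorem measurable_pBdry (hM : M.IsUniformlyContinuous) (e : E) : Measurable (M.pBdry e) :=
  (measurable_indicator_closure_comp_extendFrom (hM e).2 measurable_id).indicator
    (isClosed_closure.measurableSet.diff (M.cell_measurable _))

variable [CompleteSpace K] [T3Space K]

theorem measurable_indicator_comp_wBar (hM : M.IsUniformlyContinuous) (e : E) {f : K → ℝ≥0∞}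
    (hf : Measurable f) : Measurable ((closure (M.cell (M.i e))).indicator (f ∘ M.wBar e)) :=
  measurable_indicator_closure_comp_extendFrom (hM e).1 hf

theorem measurable_R [Countable E] (hM : M.IsUniformlyContinuous) {f : K → ℝ≥0∞}
    (hf : Measurable f) : Measurable (M.R f) :=
  measurable_tsum_ofReal_mul_comp (measurable_pBdry hM)
    (fun _ _ => pBdry_eq_zero_of_notMem_closure) fun e => measurable_indicator_comp_wBar hM e hf

theorem measurable_R_iterate [Countable E] (hM : M.IsUniformlyContinuous) {f : K → ℝ≥0∞}
    (hf : Measurable f) (n : ℕ) : Measurable (M.R^[n] f) := by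
  induction n with
  | zero => exact hf
  | succ n ih =>
    rw [Function.iterate_succ_apply']
    exact measurable_R hM ih

end BoundaryExtension

section PastCoding

variable {K E : Type*} [MeasurableSpace K] {M : MarkovSystem K E} {x : M.N → K}
  {σ : CodeSpace E}

/-- The version of the coding map that depends on the past only: the limit of the points
`backPoint`, with a junk value where they do not converge, instead of the value at the vertex
`t(σ_0)` that `coding` takes off `D`. Off `D` the two maps may differ. -/
noncomputable def pastCoding [TopologicalSpace K] (M : MarkovSystem K E) (x : M.N → K)
    (σ : CodeSpace E) : K :=
  haveI := M.nonempty
  limUnder atTop fun n => M.backPoint x n σ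

section Topological

variable [TopologicalSpace K]

theorem tendsto_pastCoding (hσ : σ ∈ M.D x) :
    Tendsto (fun n => M.backPoint x n σ) atTop (𝓝 (M.pastCoding x σ)) :=
  tendsto_nhds_limUnder hσ.2

theorem pastCoding_eq_coding [T2Space K] (hσ : σ ∈ M.D x) :
    M.pastCoding x σ = M.coding x σ := by
  rw [coding, dif_pos hσ]
  exact tendsto_nhds_unique (tendsto_pastCoding hσ) hσ.2.choose_spec

theorem pastCoding_mem_closure (hx : ∀ j, x j ∈ M.cell j) (hσ : σ ∈ M.D x) :
    M.pastCoding x σ ∈ closure (M.cell (M.tExt (σ 0))) :=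
  mem_closure_of_tendsto (tendsto_pastCoding hσ) (.of_forall (backPoint_mem_cell hx hσ.1))

/-- The shift-invariant measures for which the conditional probability of the next letter `e`,
given the past, is `q e` at the coded point. This covers the asymptotic states (`q = pBar`) and
`E_⊥` (`q = pBdry`), both by `rfl`. -/
def statesWith (M : MarkovSystem K E) (x : M.N → K) (q : E → K → ℝ) :
    Set (Measure (CodeSpace E)) :=
  {Λ | Λ ∈ CodeSpace.invariantProb E ∧ Λ (M.D x) = 1 ∧
    ∀ e, condExp (CodeSpace.past E) Λ (CodeSpace.indOne e) =ᵐ[Λ]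
      (M.T (M.i e)).indicator fun σ => q e (M.coding x σ)}

/-- The event that the coded point lies in the vertex set that the path has reached. -/
def interiorEvent (M : MarkovSystem K E) (x : M.N → K) : Set (CodeSpace E) :=
  {σ | M.pastCoding x σ ∈ M.cell (M.tExt (σ 0))}

section CompletelyMetrizable

variable [Countable E] [TopologicalSpace.IsCompletelyMetrizableSpace K]
  {Λ : Measure (CodeSpace E)} {q : E → K → ℝ}

theorem measurableSet_D : MeasurableSet (M.D x) :=
  M.measurableSet_pathSpace.inter <| CodeSpace.past_le _ <|
    @StronglyMeasurable.measurableSet_exists_tendsto _ _ _ (CodeSpace.past E) _ _ _ _ _ _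
      (M.stronglyMeasurable_backPoint x)

theorem ae_mem_D [IsProbabilityMeasure Λ] (hD : Λ (M.D x) = 1) : ∀ᵐ σ ∂Λ, σ ∈ M.D x :=
  (mem_ae_iff_prob_eq_one measurableSet_D).2 hD

theorem condLExp_ofReal_indOne (hΛ : Λ ∈ M.statesWith x q) (e : E) :
    Λ⁻[fun σ => ENNReal.ofReal (CodeSpace.indOne e σ)|CodeSpace.past E] =ᵐ[Λ]
      (M.T (M.i e)).indicator fun σ => ENNReal.ofReal (q e (M.pastCoding x σ)) := by
  have := hΛ.1.1
  filter_upwards [condLExp_ofReal (CodeSpace.past E) (CodeSpace.integrable_indOne Λ e)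
    (ae_of_all _ (CodeSpace.indOne_nonneg e)), hΛ.2.2 e, ae_mem_D hΛ.2.1] with σ hreal hq hσ
  rw [hreal, hq]
  by_cases hT : σ ∈ M.T (M.i e)
  · rw [indicator_of_mem hT, indicator_of_mem hT, pastCoding_eq_coding hσ]
  · rw [indicator_of_notMem hT, indicator_of_notMem hT, ENNReal.ofReal_zero]

theorem mem_Eperp_iff_of_measure_interiorEvent_eq_zero (h0 : Λ (M.interiorEvent x) = 0) :
    Λ ∈ M.Eperp x ↔ Λ ∈ M.asymptoticStates x := by
  refine and_congr_right fun hinv => and_congr_right fun hD => forall_congr' fun e => ?_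
  have := hinv.1
  have hq : ((M.T (M.i e)).indicator fun σ => M.pBdry e (M.coding x σ)) =ᵐ[Λ]
      (M.T (M.i e)).indicator fun σ => M.pBar e (M.coding x σ) := by
    filter_upwards [ae_mem_D hD, measure_eq_zero_iff_ae_notMem.1 h0] with σ hσ hmem
    by_cases hT : σ ∈ M.T (M.i e)
    · rw [indicator_of_mem hT, indicator_of_mem hT]
      refine pBdry_eq_pBar fun h => hmem ?_
      rwa [interiorEvent, mem_ofPred_eq, pastCoding_eq_coding hσ, hT.2]
    · rw [indicator_of_notMem hT, indicator_of_notMem hT]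
  exact ⟨fun h => h.trans hq, fun h => h.trans hq.symm⟩

theorem cond_mem_statesWith (hΛ : Λ ∈ M.statesWith x q) {B : Set (CodeSpace E)}
    (hB : MeasurableSet[CodeSpace.past E] B) (hinv : CodeSpace.shift ⁻¹' B =ᵐ[Λ] B)
    (h0 : Λ B ≠ 0) : ProbabilityTheory.cond Λ B ∈ M.statesWith x q := by
  have := hΛ.1.1
  have := ProbabilityTheory.cond_isProbabilityMeasure h0
  have hac : ProbabilityTheory.cond Λ B ≪ Λ := ProbabilityTheory.cond_absolutelyContinuous
  refine ⟨⟨inferInstance, ?_⟩, ?_, fun e => ?_⟩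
  · have hpres := hΛ.1.2.restrict_preimage (CodeSpace.past_le _ hB)
    rw [Measure.restrict_congr_set hinv] at hpres
    exact hpres.smul_measure _
  · exact (mem_ae_iff_prob_eq_one measurableSet_D).1 (hac.ae_le (ae_mem_D hΛ.2.1))
  · exact (condExp_cond_ae_eq CodeSpace.past_le hB (CodeSpace.integrable_indOne Λ e)).trans
      (hac.ae_eq (hΛ.2.2 e))

variable [BorelSpace K]

theorem measurable_pastCoding : Measurable[CodeSpace.past E] (M.pastCoding x) :=
  haveI := M.nonempty
  (@StronglyMeasurable.limUnder _ _ _ (CodeSpace.past E) _ _ _ _ _ _ _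
    (M.stronglyMeasurable_backPoint x)).measurable

theorem measurable_comp_pastCoding {β : Type*} [MeasurableSpace β] {f : K → β}
    (hf : Measurable f) : Measurable fun σ => f (M.pastCoding x σ) :=
  hf.comp (measurable_pastCoding.mono CodeSpace.past_le le_rfl)

theorem measurableSet_interiorEvent : MeasurableSet[CodeSpace.past E] (M.interiorEvent x) := by
  have hunion : M.interiorEvent x = ⋃ j, (fun σ : CodeSpace E => σ 0) ⁻¹' {a | M.tExt a = j} ∩
      M.pastCoding x ⁻¹' M.cell j := by
    ext σ
    simp only [interiorEvent, mem_iUnion, mem_inter_iff, mem_preimage, mem_ofPred_eq,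
      exists_eq_left']
  rw [hunion]
  exact @MeasurableSet.iUnion _ _ (CodeSpace.past E) _ _ fun j =>
    @MeasurableSet.inter _ (CodeSpace.past E) _ _
      (CodeSpace.measurable_past_apply le_rfl MeasurableSpace.measurableSet_top)
      (measurable_pastCoding (M.cell_measurable j))

theorem lintegral_map_coding (hD : ∀ᵐ σ ∂Λ, σ ∈ M.D x) {f : K → ℝ≥0∞} (hf : Measurable f) :
    ∫⁻ y, f y ∂Λ.map (M.coding x) = ∫⁻ σ, f (M.pastCoding x σ) ∂Λ := by
  rw [Measure.map_congr (hD.mono fun _ hσ => (pastCoding_eq_coding hσ).symm),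
    lintegral_map hf (measurable_pastCoding.mono CodeSpace.past_le le_rfl)]

theorem isProbabilityMeasure_map_coding [IsProbabilityMeasure Λ]
    (hD : ∀ᵐ σ ∂Λ, σ ∈ M.D x) : IsProbabilityMeasure (Λ.map (M.coding x)) :=
  Measure.isProbabilityMeasure_map
    ⟨M.pastCoding x, measurable_pastCoding.mono CodeSpace.past_le le_rfl,
      hD.mono fun _ hσ => (pastCoding_eq_coding hσ).symm⟩

theorem map_coding_mem_invariantMeasures_iff [IsProbabilityMeasure Λ]
    (hD : ∀ᵐ σ ∂Λ, σ ∈ M.D x) :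
    Λ.map (M.coding x) ∈ M.invariantMeasures ↔
      ∀ f : K → ℝ≥0, Measurable f → (∃ C, ∀ y, f y ≤ C) →
        ∫⁻ σ, M.U (fun z => (f z : ℝ≥0∞)) (M.pastCoding x σ) ∂Λ =
          ∫⁻ σ, (f (M.pastCoding x σ) : ℝ≥0∞) ∂Λ := by
  refine (and_iff_right (isProbabilityMeasure_map_coding hD)).trans <|
    forall₃_congr fun f hf _ => ?_
  rw [lintegral_map_coding hD (measurable_U hf.coe_nnreal_ennreal),
    lintegral_map_coding hD hf.coe_nnreal_ennreal]

end CompletelyMetrizable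

end Topological

section Shift

variable [UniformSpace K] [CompleteSpace K]

theorem tendsto_backPoint_shift (hM : M.IsUniformlyContinuous)
    (hx : ∀ j, x j ∈ M.cell j) (hσ : σ ∈ M.D x) {e : E} (he : σ 1 = (e : OnePoint E)) :
    Tendsto (fun n => M.backPoint x n (CodeSpace.shift σ)) atTop
      (𝓝 (M.wBar e (M.pastCoding x σ))) := by
  have ht : M.tExt (σ 0) = M.i e := tExt_zero_eq_i hσ.1 he
  have hcl : M.pastCoding x σ ∈ closure (M.cell (M.i e)) := ht ▸ pastCoding_mem_closure hx hσ
  have hw : Tendsto (M.w e) (𝓝[M.cell (M.i e)] M.pastCoding x σ)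
      (𝓝 (M.wBar e (M.pastCoding x σ))) :=
    tendsto_extendFrom (exists_tendsto_nhdsWithin_of_uniformContinuousOn (hM e).1 hcl)
  have hback : Tendsto (fun n => M.backPoint x n σ) atTop
      (𝓝[M.cell (M.i e)] M.pastCoding x σ) :=
    tendsto_nhdsWithin_iff.2 ⟨tendsto_pastCoding hσ,
      .of_forall fun n => ht ▸ backPoint_mem_cell hx hσ.1 n⟩
  refine (tendsto_add_atTop_iff_nat 1).1 ((hw.comp hback).congr fun n => ?_)
  rw [backPoint_shift, he]
  rfl

variable [T2Space K]

theorem pastCoding_shift (hM : M.IsUniformlyContinuous) (hx : ∀ j, x j ∈ M.cell j)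
    (hσ : σ ∈ M.D x) {e : E} (he : σ 1 = (e : OnePoint E)) :
    M.pastCoding x (CodeSpace.shift σ) = M.wBar e (M.pastCoding x σ) :=
  (tendsto_backPoint_shift hM hx hσ he).limUnder_eq

theorem shift_mem_interiorEvent (hM : M.IsUniformlyContinuous) (hx : ∀ j, x j ∈ M.cell j)
    (hσ : σ ∈ M.D x) (hmem : σ ∈ M.interiorEvent x) :
    CodeSpace.shift σ ∈ M.interiorEvent x := by
  obtain ⟨e, he⟩ := exists_apply_one_eq hσ.1
  have hcell : M.pastCoding x σ ∈ M.cell (M.i e) := tExt_zero_eq_i hσ.1 he ▸ hmem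
  rw [interiorEvent, mem_ofPred_eq, pastCoding_shift hM hx hσ he, wBar_eq_w hM hcell,
    tExt_shift_zero he]
  exact M.w_mapsTo e hcell

theorem comp_pastCoding_shift_eq_tsum (hM : M.IsUniformlyContinuous)
    (hx : ∀ j, x j ∈ M.cell j) (hσ : σ ∈ M.D x) (f : K → ℝ≥0∞) :
    f (M.pastCoding x (CodeSpace.shift σ)) =
      ∑' e, (closure (M.cell (M.i e))).indicator (f ∘ M.wBar e) (M.pastCoding x σ) *
        ENNReal.ofReal (CodeSpace.indOne e σ) := by
  obtain ⟨e, he⟩ := exists_apply_one_eq hσ.1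
  have hcl : M.pastCoding x σ ∈ closure (M.cell (M.i e)) :=
    tExt_zero_eq_i hσ.1 he ▸ pastCoding_mem_closure hx hσ
  rw [tsum_eq_single e fun e' he' => ?_, indicator_of_mem hcl, CodeSpace.indOne_of_eq he,
    ENNReal.ofReal_one, mul_one, Function.comp_apply, pastCoding_shift hM hx hσ he]
  have hne : σ 1 ≠ (e' : OnePoint E) := fun h => he' (OnePoint.coe_injective (h.symm.trans he))
  rw [CodeSpace.indOne_of_ne hne, ENNReal.ofReal_zero, mul_zero]

end Shift

end PastCoding

section States

variable {K E : Type*} [UniformSpace K] [CompleteSpace K]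
  [TopologicalSpace.IsCompletelyMetrizableSpace K] [MeasurableSpace K] [BorelSpace K]
  [Countable E] {M : MarkovSystem K E} {x : M.N → K} {Λ : Measure (CodeSpace E)}
  {q : E → K → ℝ}

theorem condLExp_comp_pastCoding_shift (hM : M.IsUniformlyContinuous)
    (hx : ∀ j, x j ∈ M.cell j) (hΛ : Λ ∈ M.statesWith x q) {f : K → ℝ≥0∞} (hf : Measurable f) :
    Λ⁻[fun σ => f (M.pastCoding x (CodeSpace.shift σ))|CodeSpace.past E] =ᵐ[Λ]
      fun σ => ∑' e, (M.T (M.i e)).indicator (fun σ =>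
        ENNReal.ofReal (q e (M.pastCoding x σ)) * f (M.wBar e (M.pastCoding x σ))) σ := by
  have := hΛ.1.1
  have hD := ae_mem_D hΛ.2.1
  let g : E → CodeSpace E → ℝ≥0∞ := fun e σ =>
    (closure (M.cell (M.i e))).indicator (f ∘ M.wBar e) (M.pastCoding x σ)
  let next : E → CodeSpace E → ℝ≥0∞ := fun e σ => ENNReal.ofReal (CodeSpace.indOne e σ)
  have hg (e : E) : Measurable[CodeSpace.past E] (g e) :=
    (measurable_indicator_comp_wBar hM e hf).comp measurable_pastCoding
  have hnext (e : E) : Measurable (next e) := (CodeSpace.measurable_indOne e).ennreal_ofReal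
  have hsplit : (fun σ => f (M.pastCoding x (CodeSpace.shift σ))) =ᵐ[Λ] ∑' e, g e * next e :=
    hD.mono fun σ hσ => (comp_pastCoding_shift_eq_tsum hM hx hσ f).trans
      (ENNReal.tsum_apply (f := fun e => g e * next e)).symm
  have hterm (e : E) : Λ⁻[g e * next e|CodeSpace.past E] =ᵐ[Λ] g e *
      (M.T (M.i e)).indicator fun σ => ENNReal.ofReal (q e (M.pastCoding x σ)) :=
    (condLExp_mul_of_measurable_left CodeSpace.past_le (hg e) (hnext e)).trans <|
      (condLExp_ofReal_indOne hΛ e).mono fun σ hσ => by rw [Pi.mul_apply, Pi.mul_apply, hσ]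
  have hsum := condLExp_tsum (P := Λ) (CodeSpace.past E) fun e =>
    (((hg e).mono CodeSpace.past_le le_rfl).mul (hnext e)).aemeasurable
  filter_upwards [condLExp_congr_ae hsplit, hsum, ae_all_iff.2 hterm, hD]
    with σ hcongr hσsum hσterm hσ
  rw [hcongr, hσsum, ENNReal.tsum_apply]
  refine tsum_congr fun e => ?_
  rw [hσterm e, Pi.mul_apply]
  by_cases hT : σ ∈ M.T (M.i e)
  · have hcl : M.pastCoding x σ ∈ closure (M.cell (M.i e)) :=
      hT.2 ▸ pastCoding_mem_closure hx hσ
    simp only [g, indicator_of_mem hT, indicator_of_mem hcl, Function.comp_apply, mul_comm]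
  · simp only [indicator_of_notMem hT, mul_zero]

theorem setLIntegral_comp_pastCoding (hM : M.IsUniformlyContinuous) (hx : ∀ j, x j ∈ M.cell j)
    (hΛ : Λ ∈ M.statesWith x q) {B : Set (CodeSpace E)}
    (hB : MeasurableSet[CodeSpace.past E] B) (hinv : CodeSpace.shift ⁻¹' B =ᵐ[Λ] B)
    {f : K → ℝ≥0∞} (hf : Measurable f) :
    ∫⁻ σ in B, f (M.pastCoding x σ) ∂Λ =
      ∫⁻ σ in B, ∑' e, (M.T (M.i e)).indicator (fun σ =>
        ENNReal.ofReal (q e (M.pastCoding x σ)) * f (M.wBar e (M.pastCoding x σ))) σ ∂Λ := by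
  have := hΛ.1.1
  calc ∫⁻ σ in B, f (M.pastCoding x σ) ∂Λ
      = ∫⁻ σ in CodeSpace.shift ⁻¹' B, f (M.pastCoding x (CodeSpace.shift σ)) ∂Λ :=
        (hΛ.1.2.setLIntegral_comp_preimage (CodeSpace.past_le _ hB)
          (measurable_comp_pastCoding hf)).symm
    _ = ∫⁻ σ in B, f (M.pastCoding x (CodeSpace.shift σ)) ∂Λ := setLIntegral_congr hinv
    _ = ∫⁻ σ in B,
          Λ⁻[fun σ => f (M.pastCoding x (CodeSpace.shift σ))|CodeSpace.past E] σ ∂Λ :=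
        (setLIntegral_condLExp CodeSpace.past_le _ _ hB).symm
    _ = _ := lintegral_congr_ae
        (ae_restrict_of_ae (condLExp_comp_pastCoding_shift hM hx hΛ hf))

-- By `shift_mem_interiorEvent` one inclusion holds a.e., and the two events have equal measure.
theorem preimage_shift_interiorEvent_ae_eq (hM : M.IsUniformlyContinuous)
    (hx : ∀ j, x j ∈ M.cell j) (hΛ : Λ ∈ CodeSpace.invariantProb E) (hD : Λ (M.D x) = 1) :
    CodeSpace.shift ⁻¹' M.interiorEvent x =ᵐ[Λ] M.interiorEvent x := by
  have := hΛ.1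
  have hA : NullMeasurableSet (M.interiorEvent x) Λ :=
    (CodeSpace.past_le _ measurableSet_interiorEvent).nullMeasurableSet
  exact (ae_eq_of_ae_subset_of_measure_ge
    ((ae_mem_D hD).mono fun _ hσ => shift_mem_interiorEvent hM hx hσ)
    (hΛ.2.measure_preimage hA).le hA (measure_ne_top _ _)).symm

theorem setLIntegral_U_interiorEvent (hM : M.IsUniformlyContinuous) (hx : ∀ j, x j ∈ M.cell j)
    (hΛ : Λ ∈ M.asymptoticStates x) {f : K → ℝ≥0∞} (hf : Measurable f) :
    ∫⁻ σ in M.interiorEvent x, M.U f (M.pastCoding x σ) ∂Λ =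
      ∫⁻ σ in M.interiorEvent x, f (M.pastCoding x σ) ∂Λ := by
  have := hΛ.1.1
  rw [setLIntegral_comp_pastCoding hM hx (q := M.pBar) hΛ measurableSet_interiorEvent
    (preimage_shift_interiorEvent_ae_eq hM hx hΛ.1 hΛ.2.1) hf]
  refine lintegral_congr_ae ?_
  filter_upwards [ae_restrict_of_ae (ae_mem_D hΛ.2.1),
    ae_restrict_mem (CodeSpace.past_le _ measurableSet_interiorEvent)]
    with σ hσ (hmem : M.pastCoding x σ ∈ M.cell (M.tExt (σ 0)))
  refine tsum_congr fun e => ?_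
  by_cases ht : M.tExt (σ 0) = M.i e
  · have hT : σ ∈ M.T (M.i e) := ⟨hσ.1, ht⟩
    rw [ht] at hmem
    rw [indicator_of_mem hT, pBar_eq_p hM hmem, wBar_eq_w hM hmem]
  · have hT : σ ∉ M.T (M.i e) := fun h => ht h.2
    rw [indicator_of_notMem hT, p_eq_zero_of_mem_cell hmem (Ne.symm ht), ENNReal.ofReal_zero,
      zero_mul]

theorem measure_interiorEvent_eq_zero (hM : M.IsUniformlyContinuous)
    (hx : ∀ j, x j ∈ M.cell j) (hΛ : Λ ∈ M.Eperp x) : Λ (M.interiorEvent x) = 0 := by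
  have hone := setLIntegral_comp_pastCoding hM hx (q := M.pBdry) hΛ measurableSet_interiorEvent
    (preimage_shift_interiorEvent_ae_eq hM hx hΛ.1 hΛ.2.1) (f := fun _ => 1) measurable_const
  rw [setLIntegral_one] at hone
  rw [hone]
  refine setLIntegral_eq_zero (CodeSpace.past_le _ measurableSet_interiorEvent) fun σ hmem => ?_
  refine ENNReal.tsum_eq_zero.2 fun e => indicator_apply_eq_zero.2 fun hT => ?_
  rw [pBdry_eq_zero_of_mem (hT.2 ▸ hmem), ENNReal.ofReal_zero, zero_mul]

theorem Eperp_subset_asymptoticStates (hM : M.IsUniformlyContinuous)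
    (hx : ∀ j, x j ∈ M.cell j) : M.Eperp x ⊆ M.asymptoticStates x := fun _ hΛ =>
  (mem_Eperp_iff_of_measure_interiorEvent_eq_zero (measure_interiorEvent_eq_zero hM hx hΛ)).1 hΛ

theorem cond_compl_interiorEvent_mem_Eperp (hM : M.IsUniformlyContinuous)
    (hx : ∀ j, x j ∈ M.cell j) (hΛ : Λ ∈ M.asymptoticStates x)
    (h0 : Λ (M.interiorEvent x)ᶜ ≠ 0) :
    ProbabilityTheory.cond Λ (M.interiorEvent x)ᶜ ∈ M.Eperp x := by
  have hA : MeasurableSet[CodeSpace.past E] (M.interiorEvent x)ᶜ :=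
    .compl measurableSet_interiorEvent
  have hnull : ProbabilityTheory.cond Λ (M.interiorEvent x)ᶜ (M.interiorEvent x) = 0 := by
    rw [ProbabilityTheory.cond_apply (CodeSpace.past_le _ hA), compl_inter_self, measure_empty,
      mul_zero]
  exact (mem_Eperp_iff_of_measure_interiorEvent_eq_zero hnull).2 <|
    cond_mem_statesWith (q := M.pBar) hΛ hA
      (preimage_shift_interiorEvent_ae_eq hM hx hΛ.1 hΛ.2.1).compl h0

theorem isConsistent_iff_forall_mem_Eperp (hM : M.IsUniformlyContinuous)
    (hx : ∀ j, x j ∈ M.cell j) :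
    M.IsConsistent x ↔ ∀ Λ ∈ M.Eperp x, Λ.map (M.coding x) ∈ M.invariantMeasures := by
  refine ⟨fun h Λ hΛ => h Λ (Eperp_subset_asymptoticStates hM hx hΛ), fun h Λ hΛ => ?_⟩
  have := hΛ.1.1
  refine (map_coding_mem_invariantMeasures_iff (ae_mem_D hΛ.2.1)).2 fun f hf hb => ?_
  have hA : MeasurableSet (M.interiorEvent x) := CodeSpace.past_le _ measurableSet_interiorEvent
  have hcompl : ∫⁻ σ in (M.interiorEvent x)ᶜ, M.U (fun z => (f z : ℝ≥0∞)) (M.pastCoding x σ) ∂Λ =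
      ∫⁻ σ in (M.interiorEvent x)ᶜ, (f (M.pastCoding x σ) : ℝ≥0∞) ∂Λ := by
    by_cases h0 : Λ (M.interiorEvent x)ᶜ = 0
    · rw [setLIntegral_measure_zero _ _ h0, setLIntegral_measure_zero _ _ h0]
    have hcond := cond_compl_interiorEvent_mem_Eperp hM hx hΛ h0
    have := hcond.1.1
    have heq := (map_coding_mem_invariantMeasures_iff (ae_mem_D hcond.2.1)).1 (h _ hcond) f hf hb
    rw [ProbabilityTheory.cond, lintegral_smul_measure, lintegral_smul_measure] at heq
    exact (ENNReal.mul_right_inj (ENNReal.inv_ne_zero.2 (measure_ne_top _ _))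
      (ENNReal.inv_ne_top.2 h0)).1 heq
  rw [← lintegral_add_compl _ hA, hcompl,
    setLIntegral_U_interiorEvent hM hx hΛ hf.coe_nnreal_ennreal, lintegral_add_compl _ hA]

theorem condLExp_comp_pastCoding_shift_le_R (hM : M.IsUniformlyContinuous)
    (hx : ∀ j, x j ∈ M.cell j) (hΛ : Λ ∈ M.Eperp x) {f : K → ℝ≥0∞} (hf : Measurable f) :
    Λ⁻[fun σ => f (M.pastCoding x (CodeSpace.shift σ))|CodeSpace.past E] ≤ᵐ[Λ]
      fun σ => M.R f (M.pastCoding x σ) :=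
  (condLExp_comp_pastCoding_shift hM hx (q := M.pBdry) hΛ hf).trans_le <| ae_of_all _ fun σ =>
    ENNReal.tsum_le_tsum fun e => indicator_le_self _ (fun σ =>
      ENNReal.ofReal (M.pBdry e (M.pastCoding x σ)) * f (M.wBar e (M.pastCoding x σ))) σ

theorem lintegral_comp_pastCoding_le_lintegral_R (hM : M.IsUniformlyContinuous)
    (hx : ∀ j, x j ∈ M.cell j) (hΛ : Λ ∈ M.Eperp x) {f : K → ℝ≥0∞} (hf : Measurable f) :
    ∫⁻ σ, f (M.pastCoding x σ) ∂Λ ≤ ∫⁻ σ, M.R f (M.pastCoding x σ) ∂Λ := by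
  have := hΛ.1.1
  calc ∫⁻ σ, f (M.pastCoding x σ) ∂Λ
      = ∫⁻ σ, f (M.pastCoding x (CodeSpace.shift σ)) ∂Λ :=
        (hΛ.1.2.lintegral_comp (measurable_comp_pastCoding hf)).symm
    _ = ∫⁻ σ, Λ⁻[fun σ => f (M.pastCoding x (CodeSpace.shift σ))|CodeSpace.past E] σ ∂Λ :=
        (lintegral_condLExp CodeSpace.past_le _ _).symm
    _ ≤ ∫⁻ σ, M.R f (M.pastCoding x σ) ∂Λ :=
        lintegral_mono_ae (condLExp_comp_pastCoding_shift_le_R hM hx hΛ hf)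

theorem ae_one_le_R_iterate_pastCoding (hM : M.IsUniformlyContinuous)
    (hx : ∀ j, x j ∈ M.cell j) (hΛ : Λ ∈ M.Eperp x) (n : ℕ) :
    ∀ᵐ σ ∂Λ, 1 ≤ M.R^[n] (fun _ => 1) (M.pastCoding x σ) := by
  have := hΛ.1.1
  induction n with
  | zero => exact ae_of_all _ fun _ => le_rfl
  | succ n ih =>
    have hshift : (fun _ => 1 : CodeSpace E → ℝ≥0∞) ≤ᵐ[Λ]
        fun σ => M.R^[n] (fun _ => 1) (M.pastCoding x (CodeSpace.shift σ)) :=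
      hΛ.1.2.quasiMeasurePreserving.ae ih
    filter_upwards [condLExp_mono (mΩ := CodeSpace.past E) hshift,
      condLExp_comp_pastCoding_shift_le_R hM hx hΛ (measurable_R_iterate hM measurable_const n)]
      with σ hmono hle
    rw [condLExp_const CodeSpace.past_le] at hmono
    rw [Function.iterate_succ_apply']
    exact hmono.trans hle

theorem ae_coding_mem_Omega (hM : M.IsUniformlyContinuous) (hx : ∀ j, x j ∈ M.cell j)
    (hΛ : Λ ∈ M.Eperp x) : ∀ᵐ σ ∂Λ, M.coding x σ ∈ M.Omega := by
  have := hΛ.1.1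
  filter_upwards [ae_mem_D hΛ.2.1, ae_all_iff.2 (ae_one_le_R_iterate_pastCoding hM hx hΛ)]
    with σ hσ hR
  rw [← pastCoding_eq_coding hσ]
  exact mem_iInter.2 hR

theorem isConsistent_of_boundaryDomination (hM : M.BoundaryDomination x)
    (hx : ∀ j, x j ∈ M.cell j) : M.IsConsistent x := by
  refine (isConsistent_iff_forall_mem_Eperp hM.1 hx).2 fun Λ hΛ => ?_
  have := hΛ.1.1
  have hD := ae_mem_D hΛ.2.1
  have := isProbabilityMeasure_map_coding hD
  refine mem_invariantMeasures_of_lintegral_le_lintegral_U fun f hf hb => ?_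
  rw [lintegral_map_coding hD hf.coe_nnreal_ennreal,
    lintegral_map_coding hD (measurable_U hf.coe_nnreal_ennreal)]
  refine (lintegral_comp_pastCoding_le_lintegral_R hM.1 hx hΛ hf.coe_nnreal_ennreal).trans <|
    lintegral_mono_ae ?_
  filter_upwards [hD, ae_coding_mem_Omega hM.1 hx hΛ] with σ hσ hΩ
  rw [pastCoding_eq_coding hσ]
  exact hM.2 f hf hb σ hΩ

end States

end MarkovSystem

theorem theorem3_general {K : Type*} [UniformSpace K] [CompleteSpace K]
    [TopologicalSpace.IsCompletelyMetrizableSpace K] [MeasurableSpace K] [BorelSpace K]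
    {E : Type*} [Countable E] (M : MarkovSystem K E)
    (x : M.N → K) (hx : ∀ j, x j ∈ M.cell j) :
    (M.IsUniformlyContinuous →
      (M.IsConsistent x ↔
        ∀ Λ ∈ M.Eperp x, Measure.map (M.coding x) Λ ∈ M.invariantMeasures)) ∧
    (M.BoundaryDomination x → M.IsConsistent x) :=
  ⟨fun hM => MarkovSystem.isConsistent_iff_forall_mem_Eperp hM hx,
    fun hM => MarkovSystem.isConsistent_of_boundaryDomination hM hx⟩

theorem theorem3 {K : Type*} [MetricSpace K] [CompleteSpace K] [MeasurableSpace K] [BorelSpace K]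
    {E : Type*} [Countable E] (M : MarkovSystem K E)
    (x : M.N → K) (hx : ∀ j, x j ∈ M.cell j) :
    (M.IsUniformlyContinuous →
      (M.IsConsistent x ↔
        ∀ Λ ∈ M.Eperp x, Measure.map (M.coding x) Λ ∈ M.invariantMeasures)) ∧
    (M.BoundaryDomination x → M.IsConsistent x) :=
  theorem3_general M x hx
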